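/- All groups are finite. Let $\sigma$ be a partition of the set of all primes, that is, a set of pairwise disjoint sets whose union is the set of all primes. For a positive integer $n$ let $\sigma(n)$ be the set of members of $\sigma$ that contain a prime divisor of $n$, and for a group $X$ let $\sigma(X)=\sigma(|X|)$. For a set $\pi$ of primes, a $\pi$-group is a group whose order has all its prime divisors in $\pi$. For a chief factor $H/K$ of a group $X$, let $C_X(H/K)$ be the centralizer of $H/K$ in $X$ under conjugation; $H/K$ is called $\sigma$-central in $X$ if for some $\sigma_i\in\sigma$ both $H/K$ and $X/C_X(H/K)$ are $\sigma_i$-groups. A group $X$ is $\sigma$-soluble if every chief factor of $X$ is a $\sigma_i$-group for some $\sigma_i\in\sigma$ (depending on the factor); it is $\sigma$-nilpotent if every chief factor of $X$ is $\sigma$-central in $X$; and, for $\sigma_i\in\sigma$, it is $\{\sigma_i\}$-nilpotent if every chief factor $H/K$ of $X$ with $\sigma_i\in\sigma(H/K)$ is $\sigma$-central in $X$. Let $F_{\{\sigma_i\}}(X)$ be the largest normal $\{\sigma_i\}$-nilpotent subgroup of $X$. An $\mathfrak N_\sigma$-critical group is a group that is not $\sigma$-nilpotent but all of whose proper subgroups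 are $\sigma$-nilpotent. For a group $G\neq 1$ define two directed graphs (loops allowed) with vertex set $\sigma(G)$: - the $\sigma$-Hawkes graph $\Gamma_{H\sigma}(G)$, in which $(\sigma_i,\sigma_j)$ is an edge if and only if $\sigma_j\in\sigma(G/F_{\{\sigma_i\}}(G))$; - the $\sigma$-Vasil'ev–Murashko graph $\Gamma_{\mathfrak N_\sigma}(G)$, in which $(\sigma_i,\sigma_j)$ is an edge if and only if $G$ has an $\mathfrak N_\sigma$-critical subgroup $H$ with $\sigma_i\in\sigma(H)$ and $\sigma_j\in\sigma(H/F_{\{\sigma_i\}}(H))$. For $\Pi\subseteq\sigma$ put $\Pi'=\sigma\setminus\Pi$. A Hall $\Pi$-subgroup of $G$ is a subgroup $H$ with $\sigma(|H|)\subseteq\Pi$ and $\sigma(|G:H|)\subseteq\Pi'$. **Proposition 1.9.** Let $G\neq 1$ be a finite group, let $\Pi\subseteq\sigma$, and let $\Pi_1=\Pi\cap\sigma(G)$ and $\Pi_2=\Pi'\cap\sigma(G)$. Let $\Gamma$ be a directed graph with vertex set $\sigma(G)$ that has no edge $(\sigma_i,\sigma_j)$ with $\sigma_i\in\Pi_2$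 and $\sigma_j\in\Pi_1$. If either $\Gamma=\Gamma_{H\sigma}(G)$, or $G$ is $\sigma$-soluble and $\Gamma=\Gamma_{\mathfrak N_\sigma}(G)$, then $G$ has a normal Hall $\Pi_1$-subgroup. -/

import Mathlib

namespace SigmaGroup

/-- `σ` is a partition of the set of all primes: its members cover exactly the primes and are
pairwise disjoint. (The empty set is tolerated as a member; it never occurs in any `σ(n)`.) -/
structure IsPrimePartition (σ : Set (Set ℕ)) : Prop where
  sUnion_eq : ⋃₀ σ = {p : ℕ | p.Prime}
  disjoint : ∀ s ∈ σ, ∀ t ∈ σ, s ≠ t → Disjoint s t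

/-- `π(n)`, the set of primes dividing `n`. -/
def primesOf (n : ℕ) : Set ℕ := {p | p.Prime ∧ p ∣ n}

/-- `σ(n)`, the set of members of `σ` that meet `π(n)`. For a finite group `X`, `σ(X)` is
`sigmaOf σ (Nat.card X)`. -/
def sigmaOf (σ : Set (Set ℕ)) (n : ℕ) : Set (Set ℕ) := {s ∈ σ | (s ∩ primesOf n).Nonempty}

/-- `n` is a `π`-number, for a set `π` of primes. -/
def IsPiNumber (π : Set ℕ) (n : ℕ) : Prop := primesOf n ⊆ π

/-- `H/K` is a chief factor of `G`: `K < H` are normal subgroups of `G` and no normal subgroup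
of `G` lies strictly between them. Its order is `K.relIndex H`. -/
structure IsChiefFactor {G : Type*} [Group G] (H K : Subgroup G) : Prop where
  normal_top : H.Normal
  normal_bot : K.Normal
  lt : K < H
  eq_or_eq : ∀ N : Subgroup G, N.Normal → K ≤ N → N ≤ H → N = K ∨ N = H

/-- `C_G(H/K)`, the preimage in `G` of the centralizer of `H/K` in `G/K`. -/
def factorCentralizer {G : Type*} [Group G] (H K : Subgroup G) [K.Normal] : Subgroup G :=
  (Subgroup.centralizer (H.map (QuotientGroup.mk' K) : Set (G ⧸ K))).comap (QuotientGroup.mk' K)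

/-- `H/K` is `π`-central in `G`: both `H/K` and `G/C_G(H/K)` are `π`-groups. -/
def IsPiCentral {G : Type*} [Group G] (π : Set ℕ) (H K : Subgroup G) [K.Normal] : Prop :=
  IsPiNumber π (K.relIndex H) ∧ IsPiNumber π (factorCentralizer H K).index

/-- `H/K` is `σ`-central in `G`: it is `σᵢ`-central for some member `σᵢ` of `σ`. -/
def IsSigmaCentral {G : Type*} [Group G] (σ : Set (Set ℕ)) (H K : Subgroup G) [K.Normal] : Prop :=
  ∃ s ∈ σ, IsPiCentral s H K

/-- `G` is `σ`-soluble: every chief factor is a `σᵢ`-group for some `i`. -/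
def IsSigmaSoluble (σ : Set (Set ℕ)) (G : Type*) [Group G] : Prop :=
  ∀ H K : Subgroup G, IsChiefFactor H K → ∃ s ∈ σ, IsPiNumber s (K.relIndex H)

/-- `G` is `σ`-nilpotent: every chief factor is `σ`-central. -/
def IsSigmaNilpotent (σ : Set (Set ℕ)) (G : Type*) [Group G] : Prop :=
  ∀ (H K : Subgroup G) [K.Normal], IsChiefFactor H K → IsSigmaCentral σ H K

/-- `G` is `{s}`-nilpotent, for a member `s` of `σ`: every chief factor `H/K` with
`s ∈ σ(H/K)`, that is, of order divisible by some prime in `s`, is `σ`-central. -/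
def IsMemberNilpotent (σ : Set (Set ℕ)) (s : Set ℕ) (G : Type*) [Group G] : Prop :=
  ∀ (H K : Subgroup G) [K.Normal], IsChiefFactor H K →
    s ∈ sigmaOf σ (K.relIndex H) → IsSigmaCentral σ H K

/-- `F_{s}(G)`, the largest normal `{s}`-nilpotent subgroup of `G`, built as the subgroup
generated by all normal `{s}`-nilpotent subgroups of `G`. -/
def memberFitting (σ : Set (Set ℕ)) (s : Set ℕ) (G : Type*) [Group G] : Subgroup G :=
  sSup {N : Subgroup G | N.Normal ∧ IsMemberNilpotent σ s N}

/-- A largest normal `{s}`-nilpotent subgroup coincides with `memberFitting`. -/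
theorem memberFitting_eq_of_isGreatest (σ : Set (Set ℕ)) (s : Set ℕ) (G : Type*) [Group G]
    (M : Subgroup G)
    (hM : IsGreatest {N : Subgroup G | N.Normal ∧ IsMemberNilpotent σ s N} M) :
    memberFitting σ s G = M :=
  hM.isLUB.sSup_eq

/-- `G` is `𝔑_σ`-critical: it is not `σ`-nilpotent but all its proper subgroups are. -/
def IsSigmaNilpotentCritical (σ : Set (Set ℕ)) (G : Type*) [Group G] : Prop :=
  ¬ IsSigmaNilpotent σ G ∧ ∀ M : Subgroup G, M ≠ ⊤ → IsSigmaNilpotent σ M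

/-- A `σ`-arithmetic graph of `G`: a directed graph (loops allowed) with vertex set `σ(G)`. -/
abbrev ArithmeticGraph (σ : Set (Set ℕ)) (G : Type*) [Group G] : Type :=
  Digraph (sigmaOf σ (Nat.card G))

/-- The `σ`-Hawkes graph: `(s, t)` is an edge iff `t ∈ σ(G/F_{s}(G))`. -/
def hawkesGraph (σ : Set (Set ℕ)) (G : Type*) [Group G] : ArithmeticGraph σ G where
  Adj s t := t.1 ∈ sigmaOf σ (Nat.card (G ⧸ memberFitting σ s.1 G))

/-- The `σ`-Vasil'ev-Murashko graph: `(s, t)` is an edge iff `s ∈ σ(H)` and `t ∈ σ(H/F_{s}(H))`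
for some `𝔑_σ`-critical subgroup `H` of `G`. -/
def vasilevMurashkoGraph (σ : Set (Set ℕ)) (G : Type*) [Group G] : ArithmeticGraph σ G where
  Adj s t := ∃ H : Subgroup G, IsSigmaNilpotentCritical σ H ∧
    s.1 ∈ sigmaOf σ (Nat.card H) ∧ t.1 ∈ sigmaOf σ (Nat.card (H ⧸ memberFitting σ s.1 H))

/-- `n` is a `Π`-number, for a subset `Π` of `σ`: `σ(n) ⊆ Π`. -/
def IsMemberNumber (σ P : Set (Set ℕ)) (n : ℕ) : Prop := sigmaOf σ n ⊆ P

/-- `H` is a Hall `Π`-subgroup of `G`: `|H|` is a `Π`-number and `|G : H|` is a `Π'`-number,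
where `Π' = σ \ Π`. -/
def IsHallSubgroup {G : Type*} [Group G] (σ P : Set (Set ℕ)) (H : Subgroup G) : Prop :=
  IsMemberNumber σ P (Nat.card H) ∧ IsMemberNumber σ (σ \ P) H.index

/-- `G` is `Π`-closed: it has a normal Hall `Π`-subgroup. -/
def IsMemberClosed (σ P : Set (Set ℕ)) (G : Type*) [Group G] : Prop :=
  ∃ H : Subgroup G, H.Normal ∧ IsHallSubgroup σ P H

end SigmaGroup

/-!
Let `π` be the union of the members of `P₁`. The claim is that `G` is `π`-closed, that is, that `G`
has a normal Hall `π`-subgroup.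

*Structure of `F_{s}(G)`.* An `{s}`-nilpotent group is `s'`-closed
(`IsMemberNilpotent.isPiClosed`): going down a chief series, a normal Hall `s'`-subgroup is lifted
across an `s`-central factor by the Schur-Zassenhaus theorem. Hence `F_{s}(G)` is an extension of
`E = O_{s'}(G)` by an `s`-group (`exists_normal_index_dvd_memberFitting`).

*The Hawkes graph.* For `s ∈ P₂` the absence of edges from `s` to `P₁` says that `G / F_{s}(G)` is
a `π'`-group; then so is `G / O_{s'}(G)`. The intersection of the subgroups `O_{s'}(G)` for
`s ∈ P₂` has `π'`-index and is itself a `π`-group (`isPiClosed_of_forall_prime`).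

*The Vasil'ev-Murashko graph.* If the `σ`-soluble group `G` is not `π`-closed, let `R` be a minimal
subgroup that is not `π`-closed. By `exists_normal_of_minimal_not_isPiClosed`, `R` has a normal
`p`-subgroup whose index is a power of `q`, with primes `p ∉ π` and `q ∈ π`. Proper subgroups of
`R` are then direct products, so `R` is `𝔑_σ`-critical, and it provides a forbidden edge from the
member of `p` to that of `q`. The structure of `R` is obtained without the conjugacy part of the
Schur-Zassenhaus theorem: `R` has a normal `π`-subgroup `A` and a normal `M ≥ A` such that `M / A` is
a `π'`-group and `R / M` a `π`-group. Unless `R` is a product `P Q` of Sylow subgroups with `P`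
normal, each Sylow subgroup `P` for a prime outside `π` satisfies `C(P) M = R`, by Frattini's
argument applied to `N(P)`, and this forces `R / A` to be a direct product.
-/

open Subgroup
open scoped commutatorElement

namespace SigmaGroup

/-! ### `π`-numbers -/

theorem IsPiNumber.of_dvd {π : Set ℕ} {m n : ℕ} (h : IsPiNumber π n) (hmn : m ∣ n) :
    IsPiNumber π m :=
  fun _ hp => h ⟨hp.1, hp.2.trans hmn⟩

theorem IsPiNumber.mono {π ρ : Set ℕ} {n : ℕ} (h : IsPiNumber π n) (hπ : π ⊆ ρ) :
    IsPiNumber ρ n :=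
  fun _ hp => hπ (h hp)

theorem IsPiNumber.mul {π : Set ℕ} {m n : ℕ} (hm : IsPiNumber π m) (hn : IsPiNumber π n) :
    IsPiNumber π (m * n) := fun _ hp =>
  (hp.1.dvd_mul.1 hp.2).elim (fun h => hm ⟨hp.1, h⟩) fun h => hn ⟨hp.1, h⟩

theorem isPiNumber_one (π : Set ℕ) : IsPiNumber π 1 :=
  fun _ hp => (hp.1.one_lt.ne' (Nat.dvd_one.1 hp.2)).elim

theorem IsPiNumber.eq_one {π : Set ℕ} {n : ℕ} (h : IsPiNumber π n) (h' : IsPiNumber πᶜ n) :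
    n = 1 := by
  by_contra hn
  obtain ⟨p, hp⟩ := Nat.exists_prime_and_dvd hn
  exact h' hp (h hp)

theorem IsPiNumber.coprime {π : Set ℕ} {m n : ℕ} (hm : IsPiNumber π m) (hn : IsPiNumber πᶜ n) :
    m.Coprime n :=
  (hm.of_dvd (Nat.gcd_dvd_left m n)).eq_one (hn.of_dvd (Nat.gcd_dvd_right m n))

theorem IsPiNumber.singleton_of_isPGroup {p : ℕ} [Fact p.Prime] {G : Type*} [Group G] [Finite G]
    (h : IsPGroup p G) : IsPiNumber {p} (Nat.card G) := by
  obtain ⟨n, hn⟩ := IsPGroup.iff_card.1 h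
  intro q hq
  exact (Nat.prime_dvd_prime_iff_eq hq.1 Fact.out).1 (hq.1.dvd_of_dvd_pow (hn ▸ hq.2))

/-! ### Groups with a normal Hall `π`-subgroup -/

/-- `G` is `π`-closed, for a set `π` of primes: it has a normal subgroup that is a `π`-group and
whose index is divisible by no prime in `π`. -/
def IsPiClosed (π : Set ℕ) (G : Type*) [Group G] : Prop :=
  ∃ N : Subgroup G, N.Normal ∧ IsPiNumber π (Nat.card N) ∧ IsPiNumber πᶜ N.index

section

variable {G : Type*} [Group G] {π : Set ℕ}

theorem le_of_isPiNumber {N H : Subgroup G} [N.Normal] (hN : IsPiNumber πᶜ N.index)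
    (hH : IsPiNumber π (Nat.card H)) : H ≤ N :=
  relIndex_eq_one.1 ((hH.of_dvd (relIndex_dvd_card N H)).eq_one
    (hN.of_dvd (relIndex_dvd_index_of_normal N H)))

/-- A normal Hall subgroup is characteristic, since it contains every `π`-subgroup. -/
theorem characteristic_of_isPiNumber {N : Subgroup G} [N.Normal]
    (h : IsPiNumber π (Nat.card N)) (h' : IsPiNumber πᶜ N.index) : N.Characteristic := by
  refine characteristic_iff_map_le.2 fun φ => le_of_isPiNumber h' ?_
  exact h.of_dvd (card_map_dvd N φ.toMonoidHom)

theorem IsPiClosed.exists_normal {M : Subgroup G} [M.Normal] (h : IsPiClosed π M) :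
    ∃ A : Subgroup G, A.Normal ∧ A ≤ M ∧ IsPiNumber π (Nat.card A) ∧
      IsPiNumber πᶜ (A.relIndex M) := by
  obtain ⟨N, hN, hc, hi⟩ := h
  have := characteristic_of_isPiNumber hc hi
  refine ⟨N.map M.subtype, inferInstance, map_subtype_le N, hc.of_dvd (card_map_dvd _ _), ?_⟩
  rwa [relIndex, subgroupOf, comap_map_eq_self_of_injective M.subtype_injective]

theorem IsPiClosed.of_mulEquiv {H : Type*} [Group H] (e : G ≃* H) (h : IsPiClosed π G) :
    IsPiClosed π H := by
  obtain ⟨N, hN, hc, hi⟩ := h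
  refine ⟨N.map e.toMonoidHom, hN.map _ e.surjective, hc.of_dvd (card_map_dvd _ _),
    hi.of_dvd (index_map_dvd N e.surjective)⟩

theorem IsPiClosed.of_quotient {A : Subgroup G} [A.Normal] (hA : IsPiNumber π (Nat.card A))
    (h : IsPiClosed π (G ⧸ A)) : IsPiClosed π G := by
  obtain ⟨N, hN, hc, hi⟩ := h
  have hs := QuotientGroup.mk'_surjective A
  refine ⟨N.comap (QuotientGroup.mk' A), inferInstance, ?_, ?_⟩
  · have hle : A ≤ N.comap (QuotientGroup.mk' A) := by
      simpa using MonoidHom.ker_le_comap (QuotientGroup.mk' A) N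
    have h1 := relIndex_mul_relIndex (⊥ : Subgroup G) A _ bot_le hle
    rw [relIndex_bot_left, relIndex_bot_left] at h1
    have h2 := relIndex_ker (K := N.comap (QuotientGroup.mk' A)) (QuotientGroup.mk' A)
    rw [QuotientGroup.ker_mk', map_comap_eq_self_of_surjective hs] at h2
    rw [← h1, h2]
    exact hA.mul hc
  · rwa [index_comap_of_surjective _ hs]

/-- In a `π`-closed group, a `π`-subgroup centralizes every normal `π'`-subgroup: it lies in the
normal Hall `π`-subgroup, which meets the normal `π'`-subgroup trivially. -/
theorem IsPiClosed.commute [Finite G] (h : IsPiClosed π G) {P Q : Subgroup G} [P.Normal]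
    (hP : IsPiNumber πᶜ (Nat.card P)) (hQ : IsPiNumber π (Nat.card Q)) {x y : G} (hx : x ∈ P)
    (hy : y ∈ Q) : Commute x y := by
  obtain ⟨N, hN, hc, hi⟩ := h
  exact commute_of_normal_of_disjoint P N inferInstance hN
    (disjoint_of_coprime_natCard (hc.coprime hP).symm) x y hx (le_of_isPiNumber hi hQ hy)

/-- A normal Hall `π'`-subgroup `K` whose centralizer has `π'`-index splits off as a direct factor:
a complement of `K`, given by the Schur-Zassenhaus theorem, is a `π`-group, so it lies in the
centralizer of `K`, and therefore it is normal. -/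
theorem isPiClosed_of_centralizer [Finite G] {K : Subgroup G} [K.Normal]
    (hK : IsPiNumber πᶜ (Nat.card K)) (hi : IsPiNumber π K.index)
    (hC : IsPiNumber πᶜ (centralizer (K : Set G)).index) : IsPiClosed π G := by
  obtain ⟨T, hT⟩ := exists_right_complement'_of_coprime (hi.coprime hK).symm
  have hTc : IsPiNumber π (Nat.card T) := hT.symm.index_eq_card ▸ hi
  have hTC : T ≤ centralizer (K : Set G) := le_of_isPiNumber hC hTc
  refine ⟨T, ?_, hTc, hT.index_eq_card.symm ▸ hK⟩
  rw [← normalizer_eq_top_iff, eq_top_iff, ← hT.sup_eq_top]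
  exact sup_le ((le_centralizer_iff.1 hTC).trans (centralizer_le_normalizer _)) le_normalizer

theorem relIndex_mul_index_sup [Finite G] (H K : Subgroup G) [K.Normal] :
    H.relIndex K * (H ⊔ K).index = H.index := by
  have h1 := relIndex_mul_relIndex ⊥ (H ⊓ K) H bot_le inf_le_left
  have h2 := relIndex_mul_relIndex ⊥ (H ⊓ K) K bot_le inf_le_right
  have h3 := relIndex_mul_index (le_sup_right : K ≤ H ⊔ K)
  simp only [relIndex_bot_left, inf_relIndex_left, inf_relIndex_right, relIndex_sup_right]
    at h1 h2 h3
  have h4 := H.card_mul_index.trans K.card_mul_index.symm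
  refine (Nat.eq_of_mul_eq_mul_left (Nat.card_pos (α := H)) ?_).symm
  rw [h4, ← h3, ← h2, ← h1]
  ring

theorem exists_sylow_le [Finite G] {q : ℕ} [Fact q.Prime] {H : Subgroup G}
    (hH : ¬ q ∣ H.index) : ∃ Q : Sylow q G, (Q : Subgroup G) ≤ H := by
  obtain ⟨Q⟩ : Nonempty (Sylow q H) := inferInstance
  refine ⟨(Q.isPGroup'.map H.subtype).toSylow ?_, map_subtype_le _⟩
  rw [index_map_subtype]
  exact Nat.Prime.not_dvd_mul Fact.out Q.not_dvd_index hH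

/-- Let `K` be a normal Hall `π'`-subgroup. If every prime `p` outside `π` has a Sylow
`p`-subgroup `P` with `C(P) K = G`, then `G` is `π`-closed. -/
theorem isPiClosed_of_centralizer_sylow_sup_eq_top [Finite G] {K : Subgroup G} [K.Normal]
    (hK : IsPiNumber πᶜ (Nat.card K)) (hi : IsPiNumber π K.index)
    (h : ∀ p : ℕ, p.Prime → p ∉ π → ∃ P : Sylow p G,
      centralizer (P : Set G) ⊔ K = ⊤) : IsPiClosed π G := by
  refine isPiClosed_of_centralizer hK hi ?_
  intro q hq hqπ
  have := Fact.mk hq.1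
  obtain ⟨Q⟩ : Nonempty (Sylow q G) := inferInstance
  -- It suffices that `K` centralizes `Q`, for then `q` cannot divide the index of `C(K)`.
  suffices hKQ : K ≤ centralizer (Q : Set G) from
    Q.not_dvd_index (hq.2.trans (index_dvd_of_le (le_centralizer_iff.1 hKQ)))
  refine relIndex_eq_one.1 (by_contra fun hne => ?_)
  obtain ⟨p, hp, hpd⟩ := Nat.exists_prime_and_dvd hne
  have hpπ : p ∉ π := hK ⟨hp, hpd.trans (relIndex_dvd_card _ K)⟩
  have := Fact.mk hp
  obtain ⟨P, hP⟩ := h p hp hpπ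
  -- `C(P)` has index dividing `|K|`, so it contains a Sylow `q`-subgroup of `G`.
  have hqi : ¬ q ∣ (centralizer (P : Set G)).index := by
    intro hd
    have h1 := relIndex_mul_index_sup (centralizer (P : Set G)) K
    rw [hP, index_top, mul_one] at h1
    exact hK ⟨hq.1, hd.trans (h1 ▸ relIndex_dvd_card _ K)⟩ hqπ
  obtain ⟨Q', hQ'⟩ := exists_sylow_le hqi
  obtain ⟨g, rfl⟩ := MulAction.exists_smul_eq G Q Q'
  have hle : ((g⁻¹ • P : Sylow p G) : Subgroup G) ≤ centralizer (Q : Set G) := by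
    intro x hx y hy
    have hx' : g * x * g⁻¹ ∈ P := by
      rw [Sylow.coe_subgroup_smul, mem_pointwise_smul_iff_inv_smul_mem] at hx
      simp only [inv_inv, ← map_inv, MulAut.smul_def, MulAut.conj_apply] at hx
      exact hx
    have hy' : g * y * g⁻¹ ∈ ((g • Q : Sylow q G) : Subgroup G) := by
      rw [Sylow.coe_subgroup_smul]
      exact smul_mem_pointwise_smul y (MulAut.conj g) _ hy
    have h1 := hQ' hy' _ hx'
    simp only [mul_assoc, inv_mul_cancel_left, mul_right_inj] at h1
    simpa only [← mul_assoc, mul_left_inj] using h1.symm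
  refine (g⁻¹ • P).not_dvd_index ((hpd.trans ?_).trans (index_dvd_of_le hle))
  exact Dvd.intro _ (relIndex_mul_index_sup _ K)

/-! ### Minimal groups that are not `π`-closed -/

/-- If `N(P) M = G` for a normal subgroup `M` whose index is a `π`-number, and the `q`-subgroups of
`N(P)` with `q ∈ π` centralize `P`, then already `C(P) M = G`. -/
theorem centralizer_sup_eq_top [Finite G] {M P : Subgroup G} [M.Normal]
    (hNM : normalizer (P : Set G) ⊔ M = ⊤) (hi : IsPiNumber π M.index)
    (h : ∀ q : ℕ, q.Prime → q ∈ π → ∀ Q : Subgroup G, IsPGroup q Q →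
      Q ≤ normalizer (P : Set G) → Q ≤ centralizer (P : Set G)) :
    centralizer (P : Set G) ⊔ M = ⊤ := by
  rw [← index_eq_one]
  by_contra hne
  obtain ⟨q, hq, hqd⟩ := Nat.exists_prime_and_dvd hne
  have := Fact.mk hq
  have hqπ : q ∈ π := hi ⟨hq, hqd.trans (index_dvd_of_le le_sup_right)⟩
  obtain ⟨Q⟩ : Nonempty (Sylow q (normalizer (P : Set G))) := inferInstance
  have hQC := h q hq hqπ _ (Q.isPGroup'.map (normalizer (P : Set G)).subtype) (map_subtype_le _)
  -- `N(P)` maps onto `G / M`, so the index of the image of `Q` in `G / M` is prime to `q`.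
  have hf : Function.Surjective
      ((QuotientGroup.mk' M).comp (normalizer (P : Set G)).subtype) := by
    rw [← MonoidHom.range_eq_top, MonoidHom.range_comp, range_subtype]
    have h := congrArg (Subgroup.map (QuotientGroup.mk' M)) hNM
    rwa [Subgroup.map_sup, QuotientGroup.map_mk'_self, sup_bot_eq,
      map_top_of_surjective _ (QuotientGroup.mk'_surjective M)] at h
  have h1 := index_map_dvd (Q : Subgroup (normalizer (P : Set G))) hf
  rw [← map_map] at h1
  have h2 := index_dvd_of_le (map_mono (f := QuotientGroup.mk' M) hQC)
  have h3 := index_map (centralizer (P : Set G)) (QuotientGroup.mk' M)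
  rw [QuotientGroup.ker_mk', MonoidHom.range_eq_top.2 (QuotientGroup.mk'_surjective M),
    index_top, mul_one] at h3
  rw [← h3] at hqd
  exact Q.not_dvd_index (hqd.trans (h2.trans h1))

/-- A group all of whose proper subgroups are `π`-closed, but which is not `π`-closed itself, is an
extension of a normal `p`-subgroup by a `q`-group, for some primes `p ∉ π` and `q ∈ π`, as soon as
it has a proper normal subgroup whose index is a `π`-number or a `π'`-number. -/
theorem exists_normal_of_minimal_not_isPiClosed [Finite G] (hG : ¬ IsPiClosed π G)
    (hproper : ∀ H : Subgroup G, H ≠ ⊤ → IsPiClosed π H) {M : Subgroup G} [M.Normal] (hM : M ≠ ⊤)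
    (hi : IsPiNumber π M.index ∨ IsPiNumber πᶜ M.index) :
    ∃ p q : ℕ, p.Prime ∧ q.Prime ∧ p ∉ π ∧ q ∈ π ∧ ∃ P : Subgroup G, P.Normal ∧
      IsPiNumber {p} (Nat.card P) ∧ IsPiNumber {q} P.index := by
  obtain ⟨A, hA, hAM, hAc, hAi⟩ := (hproper M hM).exists_normal
  by_cases hMπ : IsPiNumber πᶜ M.index
  · exact (hG ⟨A, hA, hAc, relIndex_mul_index hAM ▸ hAi.mul hMπ⟩).elim
  replace hi := hi.resolve_right hMπ
  by_contra hne
  -- The images in `G / A` satisfy the criterion above, with `K = M / A`.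
  refine hG (IsPiClosed.of_quotient (A := A) hAc ?_)
  have hs := QuotientGroup.mk'_surjective A
  have : (M.map (QuotientGroup.mk' A)).Normal := Normal.map inferInstance _ hs
  refine isPiClosed_of_centralizer_sylow_sup_eq_top (K := M.map (QuotientGroup.mk' A)) ?_ ?_ ?_
  · rwa [← relIndex_ker, QuotientGroup.ker_mk']
  · exact hi.of_dvd (index_map_dvd M hs)
  intro p hp hpπ
  have := Fact.mk hp
  obtain ⟨P⟩ : Nonempty (Sylow p G) := inferInstance
  have hPc : IsPiNumber πᶜ (Nat.card P) :=
    (IsPiNumber.singleton_of_isPGroup P.isPGroup').mono (by simpa using hpπ)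
  refine ⟨P.mapSurjective hs, ?_⟩
  suffices hCM : centralizer (P : Set G) ⊔ M = ⊤ by
    rw [eq_top_iff, ← map_top_of_surjective _ hs, ← hCM, Subgroup.map_sup]
    refine sup_le_sup_right ?_ _
    rw [map_le_iff_le_comap]
    rintro x hx _ ⟨y, hy, rfl⟩
    rw [← map_mul, hx y hy, map_mul]
  have hPM : (P : Subgroup G) ≤ M := le_of_isPiNumber (π := πᶜ) (by rwa [compl_compl]) hPc
  refine centralizer_sup_eq_top (Sylow.normalizer_sup_eq_top' P hPM) hi ?_
  intro q hq hqπ Q hQq hQN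
  have := Fact.mk hq
  have hQc : IsPiNumber {q} (Nat.card Q) := .singleton_of_isPGroup hQq
  have hQπ : IsPiNumber π (Nat.card Q) := hQc.mono (by simpa using hqπ)
  have hPR : ((P : Subgroup G) ⊔ Q) ≤ normalizer (P : Set G) := sup_le le_normalizer hQN
  by_cases hR : (P : Subgroup G) ⊔ Q = ⊤
  · have hPn : (P : Subgroup G).Normal := normalizer_eq_top_iff.1 (top_le_iff.1 (hR ▸ hPR))
    refine (hne ⟨p, q, hp, hq, hpπ, hqπ, P, hPn, .singleton_of_isPGroup P.isPGroup', ?_⟩).elim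
    rw [← relIndex_top_right, ← hR, relIndex_sup_left]
    exact hQc.of_dvd (relIndex_dvd_card _ _)
  -- The proper subgroup `P Q` is `π`-closed, so `Q` centralizes `P`.
  intro y hy x hx
  have hPn : ((P : Subgroup G).subgroupOf (P ⊔ Q)).Normal :=
    normal_subgroupOf_of_le_normalizer hPR
  have := (hproper _ hR).commute (P := (P : Subgroup G).subgroupOf (P ⊔ Q))
    (Q := Q.subgroupOf (P ⊔ Q))
    (by rwa [Nat.card_congr (subgroupOfEquivOfLe le_sup_left).toEquiv])
    (by rwa [Nat.card_congr (subgroupOfEquivOfLe le_sup_right).toEquiv])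
    (x := ⟨x, mem_sup_left hx⟩) (y := ⟨y, mem_sup_right hy⟩) hx hy
  exact congrArg Subtype.val this

end

/-! ### Members of `σ`, chief factors and radicals -/

theorem IsPrimePartition.eq_of_mem {σ : Set (Set ℕ)} (hσ : IsPrimePartition σ) {s t : Set ℕ}
    (hs : s ∈ σ) (ht : t ∈ σ) {p : ℕ} (hps : p ∈ s) (hpt : p ∈ t) : s = t :=
  by_contra fun h => Set.disjoint_left.1 (hσ.disjoint s hs t ht h) hps hpt

theorem IsPrimePartition.exists_mem {σ : Set (Set ℕ)} (hσ : IsPrimePartition σ) {p : ℕ}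
    (hp : p.Prime) : ∃ s ∈ σ, p ∈ s := by
  have : p ∈ ⋃₀ σ := hσ.sUnion_eq ▸ hp
  exact this

theorem mem_sigmaOf {σ : Set (Set ℕ)} {s : Set ℕ} {n p : ℕ} (hs : s ∈ σ) (hps : p ∈ s)
    (hp : p.Prime) (hpn : p ∣ n) : s ∈ sigmaOf σ n :=
  ⟨hs, p, hps, hp, hpn⟩

theorem isPiNumber_compl_of_notMem_sigmaOf {σ : Set (Set ℕ)} {s : Set ℕ} {n : ℕ} (hs : s ∈ σ)
    (h : s ∉ sigmaOf σ n) : IsPiNumber sᶜ n :=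
  fun _ hp hps => h (mem_sigmaOf hs hps hp.1 hp.2)

theorem IsPiNumber.index_inf {G : Type*} [Group G] {π : Set ℕ} {A B : Subgroup G} [B.Normal]
    (hA : IsPiNumber π A.index) (hB : IsPiNumber π B.index) : IsPiNumber π (A ⊓ B).index := by
  rw [← relIndex_mul_index (inf_le_left : A ⊓ B ≤ A), inf_relIndex_left]
  exact (hB.of_dvd (relIndex_dvd_index_of_normal B A)).mul hA

section

variable {G : Type*} [Group G] [Finite G] {π : Set ℕ}

theorem exists_isChiefFactor_of_ne_top {K : Subgroup G} (hK : K.Normal) (h : K ≠ ⊤) :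
    ∃ H, IsChiefFactor H K := by
  obtain ⟨V, hV⟩ := Set.Finite.exists_minimal
    (s := {V : Subgroup G | V.Normal ∧ K < V}) (Set.toFinite _) ⟨⊤, inferInstance, h.lt_top⟩
  refine ⟨V, hV.prop.1, hK, hV.prop.2, fun N hN hKN hNV => ?_⟩
  by_cases hne : N = K
  · exact .inl hne
  · exact .inr (le_antisymm hNV (hV.2 ⟨hN, lt_of_le_of_ne hKN (Ne.symm hne)⟩ hNV))

theorem exists_isChiefFactor_of_ne_bot {H : Subgroup G} (hH : H.Normal) (h : H ≠ ⊥) :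
    ∃ K, IsChiefFactor H K := by
  obtain ⟨V, hV⟩ := Set.Finite.exists_maximal
    (s := {V : Subgroup G | V.Normal ∧ V < H}) (Set.toFinite _) ⟨⊥, inferInstance, h.bot_lt⟩
  refine ⟨V, hH, hV.prop.1, hV.prop.2, fun N hN hVN hNH => ?_⟩
  by_cases hne : N = H
  · exact .inr hne
  · exact .inl (le_antisymm (hV.2 ⟨hN, lt_of_le_of_ne hNH hne⟩ hVN) hVN)

/-- The radical `O_π(G)`: there is a largest normal `π`-subgroup. -/
theorem exists_largest_normal (π : Set ℕ) (G : Type*) [Group G] [Finite G] :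
    ∃ N : Subgroup G, N.Normal ∧ IsPiNumber π (Nat.card N) ∧
      ∀ M : Subgroup G, M.Normal → IsPiNumber π (Nat.card M) → M ≤ N := by
  obtain ⟨N, hN⟩ := Set.Finite.exists_maximal
    (s := {N : Subgroup G | N.Normal ∧ IsPiNumber π (Nat.card N)}) (Set.toFinite _)
    ⟨⊥, inferInstance, by simpa using isPiNumber_one π⟩
  have := hN.prop.1
  refine ⟨N, this, hN.prop.2, fun M hM hc => le_sup_right.trans (hN.2 ?_ le_sup_left)⟩
  have h1 := relIndex_mul_relIndex (⊥ : Subgroup G) N (N ⊔ M) bot_le le_sup_left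
  rw [relIndex_bot_left, relIndex_bot_left, relIndex_sup_left] at h1
  exact ⟨inferInstance, h1 ▸ hN.prop.2.mul (hc.of_dvd (relIndex_dvd_card N M))⟩

/-- The normal subgroups of `π'`-index are closed under intersection, so the smallest of them is a
`π`-group if no prime outside `π` divides the orders of all of them. -/
theorem isPiClosed_of_forall_prime
    (h : ∀ p : ℕ, p.Prime → p ∣ Nat.card G → p ∉ π → ∃ N : Subgroup G, N.Normal ∧
      IsPiNumber πᶜ N.index ∧ ¬ p ∣ Nat.card N) : IsPiClosed π G := by
  obtain ⟨E, hE⟩ := Set.Finite.exists_minimal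
    (s := {N : Subgroup G | N.Normal ∧ IsPiNumber πᶜ N.index}) (Set.toFinite _)
    ⟨⊤, inferInstance, by simpa using isPiNumber_one πᶜ⟩
  have := hE.prop.1
  refine ⟨E, this, fun p hp => by_contra fun hpπ => ?_, hE.prop.2⟩
  obtain ⟨N, hN, hi, hpN⟩ := h p hp.1 (hp.2.trans (card_subgroup_dvd_card E)) hpπ
  exact hpN (hp.2.trans (card_dvd_of_le
    ((hE.2 ⟨inferInstance, hE.prop.2.index_inf hi⟩ inf_le_left).trans inf_le_right)))

/-! ### `{s}`-nilpotent groups and `F_{s}(G)` -/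

/-- The inductive step of `IsMemberNilpotent.isPiClosed` across a `π`-central factor `V`: if
`N / V` is a normal Hall `π'`-subgroup of `G / V`, then in `D = N ∩ C(V)` the subgroup `D ∩ V` is
central, and it has a complement in `D`, which is a normal Hall `π'`-subgroup of `G`. -/
theorem isPiClosed_compl_of_central {V N : Subgroup G} [V.Normal] [N.Normal]
    (hV : IsPiNumber π (Nat.card V)) (hC : IsPiNumber π (centralizer (V : Set G)).index)
    (hVN : IsPiNumber πᶜ (V.relIndex N)) (hN : IsPiNumber π N.index) : IsPiClosed πᶜ G := by
  have hD : IsPiClosed πᶜ (N ⊓ centralizer (V : Set G) : Subgroup G) := by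
    refine isPiClosed_of_centralizer (K := V.subgroupOf _) ?_ ?_ ?_
    · rw [compl_compl]
      exact hV.of_dvd (card_comap_dvd_of_injective _ _ (Subgroup.subtype_injective _))
    · change IsPiNumber _ (V.relIndex _)
      rw [← relIndex_subgroupOf (inf_le_left : N ⊓ centralizer (V : Set G) ≤ N)]
      exact hVN.of_dvd (relIndex_dvd_index_of_normal _ _)
    · convert isPiNumber_one _ using 1
      rw [index_eq_one, eq_top_iff]
      exact fun x _ y hy => Subtype.ext (x.2.2 y hy)
  obtain ⟨E, hE, hED, hEc, hEi⟩ := hD.exists_normal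
  refine ⟨E, hE, hEc, ?_⟩
  rw [← relIndex_mul_index hED]
  exact hEi.mul (by rw [compl_compl]; exact hN.index_inf hC)

theorem IsMemberNilpotent.isPiClosed {σ : Set (Set ℕ)} (hσ : IsPrimePartition σ) {s : Set ℕ}
    (hs : s ∈ σ) (h : IsMemberNilpotent σ s G) : IsPiClosed sᶜ G := by
  suffices H : ∀ (L : Subgroup G) [L.Normal], IsPiClosed sᶜ (G ⧸ L) from
    (H ⊥).of_quotient (by simpa using isPiNumber_one sᶜ)
  intro L
  induction L using WellFoundedGT.induction with
  | _ L ih =>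
  intro hL
  by_cases htop : L = ⊤
  · subst htop
    refine ⟨⊥, inferInstance, by simpa using isPiNumber_one sᶜ, ?_⟩
    rw [index_bot, ← index_eq_card, index_top]
    exact isPiNumber_one _
  obtain ⟨V, hV⟩ := exists_isChiefFactor_of_ne_top hL htop
  have := hV.normal_top
  obtain ⟨N, hN, hc, hi⟩ := ih V hV.lt
  have hsV := QuotientGroup.mk'_surjective V
  have hsL := QuotientGroup.mk'_surjective L
  -- `N₁` is the preimage in `G` of the normal Hall subgroup `N` of `G / V`.
  set N₁ := N.comap (QuotientGroup.mk' V) with hN₁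
  have hVN₁ : V ≤ N₁ := by
    simpa using MonoidHom.ker_le_comap (QuotientGroup.mk' V) N
  have hc₁ : IsPiNumber sᶜ (V.relIndex N₁) := by
    have := relIndex_ker (K := N₁) (QuotientGroup.mk' V)
    rw [QuotientGroup.ker_mk', map_comap_eq_self_of_surjective hsV] at this
    rwa [this]
  rw [← index_comap_of_surjective _ hsV, ← hN₁, compl_compl] at hi
  have : (V.map (QuotientGroup.mk' L)).Normal := Normal.map inferInstance _ hsL
  have : (N₁.map (QuotientGroup.mk' L)).Normal := Normal.map inferInstance _ hsL
  have hi' : IsPiNumber s (N₁.map (QuotientGroup.mk' L)).index := hi.of_dvd (index_map_dvd _ hsL)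
  have hcV : Nat.card (V.map (QuotientGroup.mk' L)) = L.relIndex V := by
    rw [← relIndex_ker, QuotientGroup.ker_mk']
  by_cases hsV' : s ∈ sigmaOf σ (L.relIndex V)
  · obtain ⟨t, ht, htV, htC⟩ := h V L hV hsV'
    obtain ⟨-, p, hps, hp⟩ := hsV'
    obtain rfl := hσ.eq_of_mem hs ht hps (htV hp)
    rw [factorCentralizer, index_comap_of_surjective _ hsL] at htC
    refine isPiClosed_compl_of_central (hcV ▸ htV) htC ?_ hi'
    rwa [relIndex_map_map, QuotientGroup.ker_mk', sup_of_le_left hV.lt.le,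
      sup_of_le_left (hV.lt.le.trans hVN₁)]
  · refine ⟨N₁.map (QuotientGroup.mk' L), inferInstance, ?_, by rwa [compl_compl]⟩
    rw [← relIndex_ker, QuotientGroup.ker_mk', ← relIndex_mul_relIndex L V N₁ hV.lt.le hVN₁]
    exact (isPiNumber_compl_of_notMem_sigmaOf hs hsV').mul hc₁

/-- The quotient of `F_{s}(G)` by `O_{s'}(G)` is an `s`-group: it lies in the largest normal
`s`-subgroup of `G / O_{s'}(G)`. -/
theorem exists_normal_index_dvd_memberFitting {σ : Set (Set ℕ)} (hσ : IsPrimePartition σ)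
    {s : Set ℕ} (hs : s ∈ σ) : ∃ E : Subgroup G, E.Normal ∧ IsPiNumber sᶜ (Nat.card E) ∧
      ∃ m, IsPiNumber s m ∧ E.index ∣ m * (memberFitting σ s G).index := by
  obtain ⟨E, hE, hEc, hEmax⟩ := exists_largest_normal sᶜ G
  obtain ⟨W, hW, hWc, hWmax⟩ := exists_largest_normal s (G ⧸ E)
  refine ⟨E, hE, hEc, Nat.card W, hWc, ?_⟩
  have hle : memberFitting σ s G ≤ W.comap (QuotientGroup.mk' E) := by
    refine sSup_le fun N hN => ?_
    have := hN.1
    obtain ⟨A, hA, hAN, hAc, hAi⟩ := (IsMemberNilpotent.isPiClosed hσ hs hN.2).exists_normal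
    rw [← map_le_iff_le_comap]
    refine hWmax _ (hN.1.map _ (QuotientGroup.mk'_surjective E)) ?_
    rw [← relIndex_ker, QuotientGroup.ker_mk']
    rw [compl_compl] at hAi
    exact hAi.of_dvd (relIndex_dvd_of_le_left N (hEmax A hA hAc))
  have h1 := index_dvd_of_le hle
  rw [index_comap_of_surjective _ (QuotientGroup.mk'_surjective E)] at h1
  rw [index_eq_card, ← W.card_mul_index]
  exact mul_dvd_mul_left _ h1

end

/-! ### `σ`-nilpotent groups -/

section

variable {G : Type*} [Group G] [Finite G] {σ : Set (Set ℕ)}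

/-- A `σ`-nilpotent group is `π`-closed for every union `π` of members of `σ`: it is `s'`-closed
for every member `s` disjoint from `π`. -/
theorem IsSigmaNilpotent.isPiClosed (hσ : IsPrimePartition σ) (h : IsSigmaNilpotent σ G)
    {Q : Set (Set ℕ)} (hQ : Q ⊆ σ) : IsPiClosed (⋃₀ Q) G := by
  refine isPiClosed_of_forall_prime fun p hp _ hpQ => ?_
  obtain ⟨s, hs, hps⟩ := hσ.exists_mem hp
  have hn : IsMemberNilpotent σ s G := fun H K _ hHK _ => h H K hHK
  obtain ⟨N, hN, hc, hi⟩ := hn.isPiClosed hσ hs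
  rw [compl_compl] at hi
  refine ⟨N, hN, hi.mono ?_, fun hpN => hc ⟨hp, hpN⟩ hps⟩
  rintro q hq ⟨t, ht, hqt⟩
  exact hpQ ⟨t, ht, hσ.eq_of_mem hs (hQ ht) hq hqt ▸ hps⟩

/-- If `A` is a normal `s`-subgroup whose index is a `t`-number, and `B` is a normal subgroup whose
index is an `s`-number and which meets `A` trivially, then the group is `σ`-nilpotent: a chief
factor covered by `A` is centralized by `B`, and one that is avoided by `A` is centralized
by `A`. -/
theorem isSigmaNilpotent_of_normal {G : Type*} [Group G] {σ : Set (Set ℕ)}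
    {s t : Set ℕ} (hs : s ∈ σ) (ht : t ∈ σ) {A B : Subgroup G}
    [A.Normal] [B.Normal] (hAB : Disjoint A B) (hA : IsPiNumber s (Nat.card A))
    (hAi : IsPiNumber t A.index) (hBi : IsPiNumber s B.index) : IsSigmaNilpotent σ G := by
  intro H K _ hHK
  have := hHK.normal_top
  rcases hHK.eq_or_eq (K ⊔ (H ⊓ A)) inferInstance le_sup_left
    (sup_le hHK.lt.le inf_le_left) with h | h
  · have hle : H ⊓ A ≤ K := sup_eq_left.1 h
    refine ⟨t, ht, ?_, ?_⟩
    · refine (hAi.of_dvd (relIndex_dvd_index_of_normal A H)).of_dvd ?_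
      exact inf_relIndex_left H A ▸ relIndex_dvd_of_le_left H hle
    · refine hAi.of_dvd (index_dvd_of_le fun a ha => ?_)
      rintro _ ⟨x, hx, rfl⟩
      have : ⁅x, a⁆ ∈ K := hle (commutator_le_inf H A (commutator_mem_commutator hx ha))
      rw [← commutatorElement_eq_one_iff_mul_comm, ← map_commutatorElement]
      exact (QuotientGroup.eq_one_iff _).2 this
  · refine ⟨s, hs, ?_, ?_⟩
    · have : K.relIndex H = K.relIndex (H ⊓ A) := by
        conv_lhs => rw [← h]
        rw [relIndex_sup_left]
      rw [this]
      exact hA.of_dvd ((relIndex_dvd_card _ _).trans (card_dvd_of_le inf_le_right))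
    · refine hBi.of_dvd (index_dvd_of_le fun b hb => ?_)
      rintro _ ⟨x, hx, rfl⟩
      rw [SetLike.mem_coe, ← h] at hx
      obtain ⟨k, hk, a, ha, rfl⟩ := mem_sup_of_normal_left.1 hx
      have hab := commute_of_normal_of_disjoint A B inferInstance inferInstance hAB a b ha.2 hb
      have hk' : (QuotientGroup.mk' K) k = 1 := (QuotientGroup.eq_one_iff k).2 hk
      rw [map_mul, hk', one_mul, ← map_mul, ← map_mul, hab.eq]

end

/-! ### The two graphs -/

/-- The passage from sets of primes to sets of members of `σ`. -/
theorem IsPiClosed.isMemberClosed {G : Type*} [Group G] {σ Q : Set (Set ℕ)}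
    (hσ : IsPrimePartition σ) (hQ : Q ⊆ σ) (h : IsPiClosed (⋃₀ Q) G) : IsMemberClosed σ Q G := by
  obtain ⟨N, hN, hc, hi⟩ := h
  refine ⟨N, hN, ?_, ?_⟩
  · rintro s ⟨hs, p, hps, hp⟩
    obtain ⟨t, ht, hpt⟩ := hc hp
    exact hσ.eq_of_mem hs (hQ ht) hps hpt ▸ ht
  · rintro s ⟨hs, p, hps, hp⟩
    exact ⟨hs, fun hsQ => hi hp ⟨s, hsQ, hps⟩⟩

section

variable {G : Type*} [Group G] [Finite G] {σ Q : Set (Set ℕ)}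

theorem isPiClosed_of_hawkesGraph (hσ : IsPrimePartition σ) (hQ : Q ⊆ σ)
    (h : ∀ s ∈ sigmaOf σ (Nat.card G), s ∉ Q → ∀ t ∈ Q,
      t ∉ sigmaOf σ (Nat.card (G ⧸ memberFitting σ s G))) : IsPiClosed (⋃₀ Q) G := by
  refine isPiClosed_of_forall_prime fun p hp hpG hpQ => ?_
  obtain ⟨s, hs, hps⟩ := hσ.exists_mem hp
  have hsQ : s ∉ Q := fun hsQ => hpQ ⟨s, hsQ, hps⟩
  obtain ⟨E, hE, hc, m, hm, hEi⟩ := exists_normal_index_dvd_memberFitting (G := G) hσ hs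
  refine ⟨E, hE, ?_, fun hpE => hc ⟨hp, hpE⟩ hps⟩
  refine IsPiNumber.of_dvd (.mul (hm.mono ?_) ?_) hEi
  · rintro q hq ⟨t, ht, hqt⟩
    exact hsQ (hσ.eq_of_mem hs (hQ ht) hq hqt ▸ ht)
  · rintro q hq ⟨t, ht, hqt⟩
    exact h s (mem_sigmaOf hs hps hp hpG) hsQ t ht
      (mem_sigmaOf (hQ ht) hqt hq.1 hq.2)

/-- A nontrivial subgroup `R` of a `σ`-soluble group has a proper normal subgroup whose index is an
`s`-number for some `s ∈ σ`: its intersection with `K`, where `H / K` is a chief factor of the whole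
group and `H` is the normal closure of `R`. -/
theorem IsSigmaSoluble.exists_normal (h : IsSigmaSoluble σ G) {R : Subgroup G} (hR : R ≠ ⊥) :
    ∃ M : Subgroup R, M.Normal ∧ M ≠ ⊤ ∧ ∃ s ∈ σ, IsPiNumber s M.index := by
  have hle : R ≤ normalClosure (R : Set G) := le_normalClosure
  obtain ⟨K, hK⟩ := exists_isChiefFactor_of_ne_bot (H := normalClosure (R : Set G))
    inferInstance (ne_bot_of_le_ne_bot hR hle)
  obtain ⟨s, hs, hsn⟩ := h _ K hK
  have := hK.normal_bot
  refine ⟨K.subgroupOf R, inferInstance, fun htop => ?_, s, hs, ?_⟩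
  · exact hK.lt.not_ge (normalClosure_le_normal (N := K) (subgroupOf_eq_top.1 htop))
  · change IsPiNumber s (K.relIndex R)
    rw [← relIndex_subgroupOf hle]
    exact hsn.of_dvd (relIndex_dvd_index_of_normal _ _)

/-- The extensions found in `exists_normal_of_minimal_not_isPiClosed` are critical: a proper
subgroup is the direct product of its intersection with `P` and its normal Hall `π`-subgroup. -/
theorem isSigmaNilpotentCritical_of_minimal (hσ : IsPrimePartition σ) (hQ : Q ⊆ σ)
    (hG : ¬ IsPiClosed (⋃₀ Q) G) (hproper : ∀ H : Subgroup G, H ≠ ⊤ → IsPiClosed (⋃₀ Q) H)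
    {s t : Set ℕ} (hs : s ∈ σ) (hsQ : s ∉ Q) (ht : t ∈ Q) {P : Subgroup G} [P.Normal]
    (hP : IsPiNumber s (Nat.card P)) (hPi : IsPiNumber t P.index) :
    IsSigmaNilpotentCritical σ G := by
  refine ⟨fun hn => hG (hn.isPiClosed hσ hQ), fun H hH => ?_⟩
  obtain ⟨B, hB, hBc, hBi⟩ := hproper H hH
  have hsc : s ⊆ (⋃₀ Q)ᶜ := by
    rintro q hq ⟨u, hu, hqu⟩
    exact hsQ (hσ.eq_of_mem hs (hQ hu) hq hqu ▸ hu)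
  have hPc : IsPiNumber s (Nat.card (P.subgroupOf H)) :=
    hP.of_dvd (card_comap_dvd_of_injective _ _ H.subtype_injective)
  refine isSigmaNilpotent_of_normal hs (hQ ht) (A := P.subgroupOf H) (B := B)
    (disjoint_of_coprime_natCard (hBc.coprime (hPc.mono hsc)).symm) hPc
    (hPi.of_dvd (relIndex_dvd_index_of_normal P H)) ?_
  -- No prime in `t` divides the index of `B`, while `|G| = |P| |G : P|` is the product of an
  -- `s`-number and a `t`-number.
  intro q hq
  have hqG : q ∣ Nat.card P * P.index :=
    hq.2.trans (B.index_dvd_card.trans (P.card_mul_index ▸ card_subgroup_dvd_card H))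
  rcases hq.1.dvd_mul.1 hqG with hd | hd
  · exact hP ⟨hq.1, hd⟩
  · exact (hBi hq ⟨t, ht, hPi ⟨hq.1, hd⟩⟩).elim

theorem isPiClosed_of_vasilevMurashkoGraph (hσ : IsPrimePartition σ) (hQ : Q ⊆ σ)
    (hsol : IsSigmaSoluble σ G)
    (h : ∀ s ∈ sigmaOf σ (Nat.card G), s ∉ Q → ∀ t ∈ Q, ∀ H : Subgroup G,
      IsSigmaNilpotentCritical σ H → s ∈ sigmaOf σ (Nat.card H) →
        t ∉ sigmaOf σ (Nat.card (H ⧸ memberFitting σ s H))) : IsPiClosed (⋃₀ Q) G := by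
  by_contra hG
  obtain ⟨R, hR⟩ := Set.Finite.exists_minimal
    (s := {R : Subgroup G | ¬ IsPiClosed (⋃₀ Q) R}) (Set.toFinite _)
    ⟨⊤, fun h => hG (h.of_mulEquiv topEquiv)⟩
  have hRn : ¬ IsPiClosed (⋃₀ Q) R := hR.prop
  have hproper : ∀ H : Subgroup R, H ≠ ⊤ → IsPiClosed (⋃₀ Q) H := by
    intro H hH
    by_contra hn
    have hn' : ¬ IsPiClosed (⋃₀ Q) (H.map R.subtype) := fun h =>
      hn (h.of_mulEquiv (equivMapOfInjective H R.subtype R.subtype_injective).symm)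
    have hle : R ≤ H.map R.subtype := hR.2 hn' (map_subtype_le H)
    refine hH (top_le_iff.1 fun x _ => ?_)
    obtain ⟨y, hy, hyx⟩ := hle x.2
    exact Subtype.ext (hyx) ▸ hy
  have hRbot : R ≠ ⊥ := by
    rintro rfl
    exact hRn ⟨⊤, inferInstance, by simpa using isPiNumber_one _, by simpa using isPiNumber_one _⟩
  have hcompl : ∀ s ∈ σ, s ∉ Q → s ⊆ (⋃₀ Q)ᶜ := by
    rintro s hs hsQ q hq ⟨u, hu, hqu⟩
    exact hsQ (hσ.eq_of_mem hs (hQ hu) hq hqu ▸ hu)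
  obtain ⟨M, hM, hMtop, u, hu, hMi⟩ := hsol.exists_normal hRbot
  have hMi' : IsPiNumber (⋃₀ Q) M.index ∨ IsPiNumber (⋃₀ Q)ᶜ M.index := by
    by_cases huQ : u ∈ Q
    · exact .inl (hMi.mono (Set.subset_sUnion_of_mem huQ))
    · exact .inr (hMi.mono (hcompl u hu huQ))
  obtain ⟨p, q, hp, hq, hpQ, ⟨t, ht, hqt⟩, P, hPn, hPc, hPi⟩ :=
    exists_normal_of_minimal_not_isPiClosed hRn hproper hMtop hMi'
  obtain ⟨s, hs, hps⟩ := hσ.exists_mem hp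
  have hsQ : s ∉ Q := fun hsQ => hpQ ⟨s, hsQ, hps⟩
  replace hPc : IsPiNumber s (Nat.card P) := hPc.mono (by simpa using hps)
  replace hPi : IsPiNumber t P.index := hPi.mono (by simpa using hqt)
  have htQ : t ⊆ ⋃₀ Q := Set.subset_sUnion_of_mem ht
  have hst : ∀ n, n ∣ Nat.card R → IsPiNumber sᶜ n → IsPiNumber t n := by
    intro n hn hns r hr
    rcases hr.1.dvd_mul.1 (P.card_mul_index ▸ hr.2.trans hn) with hd | hd
    · exact (hns hr (hPc ⟨hr.1, hd⟩)).elim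
    · exact hPi ⟨hr.1, hd⟩
  have hsR : s ∈ sigmaOf σ (Nat.card R) := by
    by_contra hsR
    have hRt := hst _ dvd_rfl (isPiNumber_compl_of_notMem_sigmaOf hs hsR)
    exact hRn ⟨⊤, inferInstance, (hRt.mono htQ).of_dvd (card_subgroup_dvd_card _),
      by simpa using isPiNumber_one _⟩
  have hsG : s ∈ sigmaOf σ (Nat.card G) := by
    obtain ⟨-, r, hrs, hr⟩ := hsR
    exact mem_sigmaOf hs hrs hr.1 (hr.2.trans (card_subgroup_dvd_card R))
  have htF := h s hsG hsQ t ht R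
    (isSigmaNilpotentCritical_of_minimal hσ hQ hRn hproper hs hsQ ht hPc hPi) hsR
  -- Otherwise `R / F_{s}(R)` is an `s`-group, and so is `R / E` with `E = O_{s'}(R)`.
  obtain ⟨E, hE, hEc, m, hm, hEi⟩ := exists_normal_index_dvd_memberFitting (G := R) hσ hs
  refine hRn ⟨E, hE, (hst _ (card_subgroup_dvd_card E) hEc).mono htQ, ?_⟩
  refine IsPiNumber.of_dvd (.mul (hm.mono (hcompl s hs hsQ)) ?_) hEi
  intro r hr hrQ
  rw [index_eq_card] at hr
  rcases hr.1.dvd_mul.1 (P.card_mul_index ▸ hr.2.trans (card_quotient_dvd_card _)) with hd | hd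
  · exact hcompl s hs hsQ (hPc ⟨hr.1, hd⟩) hrQ
  · exact htF (mem_sigmaOf (hQ ht) (hPi ⟨hr.1, hd⟩) hr.1 hr.2)

end
end SigmaGroup

theorem proposition1p9 (G : Type*) [Group G] [Finite G] [Nontrivial G]
    (σ : Set (Set ℕ)) (hσ : SigmaGroup.IsPrimePartition σ)
    (P P₁ P₂ : Set (Set ℕ)) (hP : P ⊆ σ)
    (hP₁ : P₁ = P ∩ SigmaGroup.sigmaOf σ (Nat.card G))
    (hP₂ : P₂ = (σ \ P) ∩ SigmaGroup.sigmaOf σ (Nat.card G))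
    (Γ : SigmaGroup.ArithmeticGraph σ G)
    (hedge : ∀ s t : SigmaGroup.sigmaOf σ (Nat.card G), s.1 ∈ P₂ → t.1 ∈ P₁ → ¬ Γ.Adj s t)
    (hΓ : Γ = SigmaGroup.hawkesGraph σ G ∨
      (SigmaGroup.IsSigmaSoluble σ G ∧ Γ = SigmaGroup.vasilevMurashkoGraph σ G)) :
    SigmaGroup.IsMemberClosed σ P₁ G := by
  have hP₁σ : P₁ ⊆ σ := hP₁ ▸ Set.inter_subset_left.trans hP
  have hedge' : ∀ (s : Set ℕ) (hs : s ∈ SigmaGroup.sigmaOf σ (Nat.card G)), s ∉ P₁ →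
      ∀ (t : Set ℕ) (ht : t ∈ P₁), ¬ Γ.Adj ⟨s, hs⟩ ⟨t, (hP₁ ▸ ht).2⟩ := by
    intro s hs hsP t ht
    refine hedge ⟨s, hs⟩ ⟨t, _⟩ ?_ ht
    rw [hP₂]
    rw [hP₁] at hsP
    exact ⟨⟨hs.1, fun h => hsP ⟨h, hs⟩⟩, hs⟩
  refine SigmaGroup.IsPiClosed.isMemberClosed hσ hP₁σ ?_
  rcases hΓ with rfl | ⟨hsol, rfl⟩
  · exact SigmaGroup.isPiClosed_of_hawkesGraph hσ hP₁σ hedge'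
  · exact SigmaGroup.isPiClosed_of_vasilevMurashkoGraph hσ hP₁σ hsol
      fun s hs hsP t ht H hH hsH htH => hedge' s hs hsP t ht ⟨H, hH, hsH, htH⟩
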